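/- Let $d,m,k\ge 1$ be integers and let $\mathbb B^d=\{x\in\mathbb R^d:|x|<1\}$. Let $H^k(\mathbb B^d,\mathbb C^m)$ be the Sobolev space of all $f\in L^2(\mathbb B^d,\mathbb C^m)$ whose weak derivatives $\partial^\alpha f$ with $|\alpha|\le k$ belong to $L^2(\mathbb B^d,\mathbb C^m)$, and for integers $j$ with $0\le j\le k$ put $$\|f\|_{H^j}^2=\sum_{|\alpha|\le j}\|\partial^\alpha f\|_{L^2}^2,\qquad \|f\|_{\dot H^j}^2=\sum_{|\alpha|=j}\|\partial^\alpha f\|_{L^2}^2,$$ where $\alpha$ runs over multi-indices in $\mathbb N_0^d$ and $L^2=L^2(\mathbb B^d,\mathbb C^m)$. Let $(\cdot|\cdot)$ be an inner product on the complex vector space $H^k(\mathbb B^d,\mathbb C^m)$ whose induced norm $\|\cdot\|$ is equivalent to $\|\cdot\|_{H^k}$. Then for every $\varepsilon>0$ there exist a constant $C>0$ and a finite set $\{f_n\}_{n=1}^N\subseteq H^k(\mathbb B^d,\mathbb C^m)$, orthonormal with respect to $(\cdot|\cdot)$, such that $$\|f\|_{H^{k-1}}^2\le \varepsilon\,\|f\|_{\dot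 H^k}^2+C\sum_{n=1}^N|(f|f_n)|^2\qquad\text{for all } f\in H^k(\mathbb B^d,\mathbb C^m).$$ -/

import Mathlib

open MeasureTheory
open scoped ContDiff

noncomputable section

namespace BallSobolev

/-- The open unit ball of `ℝ^d`, with respect to the Euclidean norm. -/
def unitBall (d : ℕ) : Set (EuclideanSpace ℝ (Fin d)) := Metric.ball 0 1

/-- Lebesgue measure on the open unit ball of `ℝ^d`. -/
def ballMeasure (d : ℕ) : Measure (EuclideanSpace ℝ (Fin d)) :=
  (volume : Measure (EuclideanSpace ℝ (Fin d))).restrict (unitBall d)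

instance (d : ℕ) : IsFiniteMeasure (ballMeasure d) :=
  ⟨by simpa [ballMeasure, unitBall] using measure_ball_lt_top⟩

/-- The complex Hilbert space `L²(𝔹^d, ℂ^m)`, where `ℂ^m` carries its Euclidean norm. -/
abbrev L2 (d m : ℕ) : Type :=
  Lp (EuclideanSpace ℂ (Fin m)) 2 (ballMeasure d)

/-- The partial derivative `∂_i φ` of a real-valued function on `ℝ^d`. -/
def partialDeriv {d : ℕ} (i : Fin d) (φ : EuclideanSpace ℝ (Fin d) → ℝ) :
    EuclideanSpace ℝ (Fin d) → ℝ :=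
  fun x => fderiv ℝ φ x (EuclideanSpace.single i (1 : ℝ))

/-- The derivative `∂^α φ = ∂_1^{α_1} ⋯ ∂_d^{α_d} φ` for a multi-index `α ∈ ℕ^d`. -/
def multiDeriv {d : ℕ} (α : Fin d → ℕ) (φ : EuclideanSpace ℝ (Fin d) → ℝ) :
    EuclideanSpace ℝ (Fin d) → ℝ :=
  (List.finRange d).foldr (fun i h => (partialDeriv i)^[α i] h) φ

/-- `φ` is a test function on the unit ball: smooth with compact support inside the ball. -/
structure IsTest {d : ℕ} (φ : EuclideanSpace ℝ (Fin d) → ℝ) : Prop where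
  smooth : ContDiff ℝ ∞ φ
  compact : HasCompactSupport φ
  support_subset : tsupport φ ⊆ unitBall d

/-- `g` is the weak derivative `∂^α f` on the unit ball:
`∫ (∂^α φ) f = (-1)^{|α|} ∫ φ g` for all test functions `φ`. -/
def HasWeakDeriv {d m : ℕ} (α : Fin d → ℕ) (f g : L2 d m) : Prop :=
  ∀ φ : EuclideanSpace ℝ (Fin d) → ℝ, IsTest φ →
    ∫ x, multiDeriv α φ x • f x ∂(ballMeasure d) =
      (-1 : ℝ) ^ (∑ i, α i) • ∫ x, φ x • g x ∂(ballMeasure d)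

theorem IsTest.partialDeriv {d : ℕ} {φ : EuclideanSpace ℝ (Fin d) → ℝ} (hφ : IsTest φ)
    (i : Fin d) : IsTest (partialDeriv i φ) where
  smooth := by
    have h : ContDiff ℝ ∞ (fderiv ℝ φ) := hφ.smooth.fderiv_right (by simp)
    exact h.clm_apply contDiff_const
  compact := hφ.compact.fderiv_apply (𝕜 := ℝ) _
  support_subset := (tsupport_fderiv_apply_subset ℝ _).trans hφ.support_subset

theorem IsTest.multiDeriv {d : ℕ} {φ : EuclideanSpace ℝ (Fin d) → ℝ} (hφ : IsTest φ)
    (α : Fin d → ℕ) : IsTest (multiDeriv α φ) := by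
  unfold BallSobolev.multiDeriv
  induction List.finRange d with
  | nil => exact hφ
  | cons i l ih =>
    simp only [List.foldr_cons]
    induction α i with
    | zero => exact ih
    | succ n ihn =>
      rw [Function.iterate_succ_apply']
      exact ihn.partialDeriv i

theorem IsTest.integrable_smul {d m : ℕ} {φ : EuclideanSpace ℝ (Fin d) → ℝ} (hφ : IsTest φ)
    (f : L2 d m) : Integrable (fun x => φ x • f x) (ballMeasure d) := by
  have hf : Integrable f (ballMeasure d) := (Lp.memLp f).integrable (by norm_num)
  obtain ⟨C, hC⟩ := hφ.compact.exists_bound_of_continuous hφ.smooth.continuous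
  exact hf.bdd_smul C hφ.smooth.continuous.aestronglyMeasurable (.of_forall hC)

theorem HasWeakDeriv.zero {d m : ℕ} (α : Fin d → ℕ) :
    HasWeakDeriv α (0 : L2 d m) 0 := by
  intro φ _
  have h0 : ∀ ψ : EuclideanSpace ℝ (Fin d) → ℝ,
      ∫ x, ψ x • (0 : L2 d m) x ∂(ballMeasure d) = 0 := fun ψ =>
    integral_eq_zero_of_ae <| by
      filter_upwards [Lp.coeFn_zero (EuclideanSpace ℂ (Fin m)) 2 (ballMeasure d)] with x hx
      rw [hx, Pi.zero_apply, smul_zero]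
  rw [h0, h0, smul_zero]

theorem HasWeakDeriv.add {d m : ℕ} {α : Fin d → ℕ} {f₁ f₂ g₁ g₂ : L2 d m}
    (h₁ : HasWeakDeriv α f₁ g₁) (h₂ : HasWeakDeriv α f₂ g₂) :
    HasWeakDeriv α (f₁ + f₂) (g₁ + g₂) := by
  intro φ hφ
  have key : ∀ ψ : EuclideanSpace ℝ (Fin d) → ℝ, IsTest ψ → ∀ u v : L2 d m,
      ∫ x, ψ x • (u + v : L2 d m) x ∂(ballMeasure d) =
        ∫ x, ψ x • u x ∂(ballMeasure d) + ∫ x, ψ x • v x ∂(ballMeasure d) := by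
    intro ψ hψ u v
    rw [← integral_add (hψ.integrable_smul u) (hψ.integrable_smul v)]
    refine integral_congr_ae ?_
    filter_upwards [Lp.coeFn_add u v] with x hx
    rw [hx, Pi.add_apply, smul_add]
  rw [key _ (hφ.multiDeriv α), key _ hφ, h₁ φ hφ, h₂ φ hφ, smul_add]

theorem HasWeakDeriv.smul {d m : ℕ} {α : Fin d → ℕ} {f g : L2 d m} (c : ℂ)
    (h : HasWeakDeriv α f g) : HasWeakDeriv α (c • f) (c • g) := by
  intro φ hφ
  have key : ∀ ψ : EuclideanSpace ℝ (Fin d) → ℝ, ∀ u : L2 d m,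
      ∫ x, ψ x • (c • u : L2 d m) x ∂(ballMeasure d) =
        c • ∫ x, ψ x • u x ∂(ballMeasure d) := by
    intro ψ u
    rw [← integral_smul]
    refine integral_congr_ae ?_
    filter_upwards [Lp.coeFn_smul c u] with x hx
    rw [hx, Pi.smul_apply, smul_comm]
  rw [key, key, h φ hφ, smul_comm]

/-- Weak derivatives are unique. -/
theorem HasWeakDeriv.unique {d m : ℕ} {α : Fin d → ℕ} {f g₁ g₂ : L2 d m}
    (h₁ : HasWeakDeriv α f g₁) (h₂ : HasWeakDeriv α f g₂) : g₁ = g₂ := by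
  have h : HasWeakDeriv α (0 : L2 d m) (g₁ - g₂) := by
    have := h₁.add (h₂.smul (-1))
    simpa [sub_eq_add_neg] using this
  have hz : ∀ᵐ x ∂(volume : Measure (EuclideanSpace ℝ (Fin d))), x ∈ unitBall d →
      (g₁ - g₂ : L2 d m) x = 0 := by
    refine Metric.isOpen_ball.ae_eq_zero_of_integral_contDiff_smul_eq_zero ?_ ?_
    · have hi : IntegrableOn (g₁ - g₂ : L2 d m) (unitBall d) volume :=
        (Lp.memLp (g₁ - g₂ : L2 d m)).integrable (by norm_num)
      exact hi.locallyIntegrableOn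
    · intro φ hφ hc hs
      have e := h φ ⟨hφ, hc, hs⟩
      have e0 : ∫ x, multiDeriv α φ x • (0 : L2 d m) x ∂(ballMeasure d) = 0 :=
        integral_eq_zero_of_ae <| by
          filter_upwards [Lp.coeFn_zero (EuclideanSpace ℂ (Fin m)) 2 (ballMeasure d)] with x hx
          rw [hx, Pi.zero_apply, smul_zero]
      rw [e0] at e
      have e1 : ∫ x, φ x • (g₁ - g₂ : L2 d m) x ∂(ballMeasure d) = 0 := by
        rcases smul_eq_zero.mp e.symm with h' | h'
        · exact absurd h' (pow_ne_zero _ (by norm_num))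
        · exact h'
      rw [← e1]
      refine (setIntegral_eq_integral_of_forall_compl_eq_zero fun x hx => ?_).symm
      have : φ x = 0 := image_eq_zero_of_notMem_tsupport fun hx' => hx (hs hx')
      simp [this]
  have hz' : (g₁ - g₂ : L2 d m) =ᵐ[ballMeasure d] 0 :=
    (ae_restrict_iff' Metric.isOpen_ball.measurableSet).mpr hz
  exact sub_eq_zero.mp ((Lp.eq_zero_iff_ae_eq_zero).mpr hz')

open Classical in
/-- The weak derivative `∂^α f ∈ L²(𝔹^d, ℂ^m)` (set to `0` if it does not exist in `L²`). -/
def weakDeriv {d m : ℕ} (α : Fin d → ℕ) (f : L2 d m) : L2 d m :=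
  if h : ∃ g, HasWeakDeriv α f g then h.choose else 0

theorem HasWeakDeriv.weakDeriv_eq {d m : ℕ} {α : Fin d → ℕ} {f g : L2 d m}
    (h : HasWeakDeriv α f g) : weakDeriv α f = g := by
  have h' : ∃ g, HasWeakDeriv α f g := ⟨g, h⟩
  rw [weakDeriv, dif_pos h']
  exact h'.choose_spec.unique h

/-- The finite set of multi-indices `α ∈ ℕ^d` with `|α| = j`. -/
def multiIndices (d j : ℕ) : Finset (Fin d → ℕ) := Finset.piAntidiag Finset.univ j

/-- The Sobolev space `H^k(𝔹^d, ℂ^m)`: all `f ∈ L²` whose weak derivatives `∂^α f` with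
`|α| ≤ k` exist in `L²`. -/
def H (d m k : ℕ) : Submodule ℂ (L2 d m) where
  carrier := {f | ∀ α : Fin d → ℕ, ∑ i, α i ≤ k → ∃ g, HasWeakDeriv α f g}
  zero_mem' := fun α _ => ⟨0, HasWeakDeriv.zero α⟩
  add_mem' := fun hf hg α hα =>
    (hf α hα).elim fun _ hu => (hg α hα).elim fun _ hv => ⟨_, hu.add hv⟩
  smul_mem' := fun c _ hf α hα => (hf α hα).elim fun _ hu => ⟨_, hu.smul c⟩

/-- The homogeneous seminorm `‖f‖_{Ḣ^k} = (∑_{|α| = k} ‖∂^α f‖_{L²}²)^{1/2}`. -/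
def homNorm {d m : ℕ} (k : ℕ) (f : L2 d m) : ℝ :=
  Real.sqrt (∑ α ∈ multiIndices d k, ‖weakDeriv α f‖ ^ 2)

/-- The Sobolev norm `‖f‖_{H^k} = (∑_{|α| ≤ k} ‖∂^α f‖_{L²}²)^{1/2}`. -/
def sobolevNorm {d m : ℕ} (k : ℕ) (f : L2 d m) : ℝ :=
  Real.sqrt (∑ j ∈ Finset.range (k + 1), ∑ α ∈ multiIndices d j, ‖weakDeriv α f‖ ^ 2)

/-- The norm `‖f‖ = (f|f)^{1/2}` induced by an inner product on a complex vector space. -/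
def inducedNorm {V : Type*} [AddCommGroup V] [Module ℂ V] (ip : InnerProductSpace.Core ℂ V)
    (f : V) : ℝ :=
  Real.sqrt (ip.inner f f).re

/-- The norm induced by the inner product `ip` is equivalent to the `H^k` norm. -/
def EquivalentToSobolev {d m k : ℕ} (ip : InnerProductSpace.Core ℂ (H d m k)) : Prop :=
  ∃ a b : ℝ, 0 < a ∧ 0 < b ∧ ∀ f : H d m k,
    a * sobolevNorm k (f : L2 d m) ≤ inducedNorm ip f ∧
      inducedNorm ip f ≤ b * sobolevNorm k (f : L2 d m)

end BallSobolev

end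

/-!
The theorem is a quantitative form of the compactness of the embedding `H^k ⊆ H^(k-1)` on the ball.
It is proved directly from a Poincaré inequality on small convex sets.

Cut the ball by a grid into finitely many convex cells `Q` of diameter at most `s`
(`exists_convex_partition`). On each cell, the `L²` norm of `u` is controlled by the mean of `u` and
by the mean square oscillation `|Q|⁻¹ ∫_Q ∫_Q |u x - u y|²` (`lintegral_enorm_sq_le_oscillation`).
For a `C¹` function, the fundamental theorem of calculus on the segments between points of a convex
set bounds the oscillation by a multiple of `s² ∫_Q |∇u|²` (`lintegral_prod_enorm_sub_sq_le`). The
constant depends only on the dimension, so thin cells at the boundary of the ball do no harm. The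
bound passes to functions with a weak gradient by mollification and Fatou's lemma
(`sum_oscillation_mollify_le`, `sum_oscillation_le`). Summing over the cells gives, for every
`δ > 0`, finitely many continuous functionals `l_n` on `L²` (the means over the cells, up to
factors) with `‖u‖² ≤ δ ‖∇u‖² + ∑ |l_n u|²` (`exists_functionals_norm_sq_le`).

Apply this to all derivatives `∂^α f` with `|α| < k`, whose weak gradients consist of the
derivatives of order `|α| + 1` (`homNorm_sq_le_of_functionals`). Summing and absorbing the lower
order terms bounds the `H^(k-1)` norm by a small multiple of the homogeneous `H^k` norm and the
finitely many functionals `f ↦ l_n (∂^α f)`, which are bounded on `H^k`. These are limits, in the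
dual norm, of inner products with elements of `H^k`; the orthonormal family is a basis of the span
of finitely many such elements, and the approximation error is absorbed as well
(`exists_orthonormal_sum_norm_sq_le`). No completeness of `H^k` is needed.
-/

noncomputable section

namespace BallSobolev

section Poincare

open Set Filter Topology ContinuousLinearMap
open scoped ENNReal Convolution

/-! ### The Poincaré inequality for `C¹` functions on convex sets -/

theorem sq_lintegral_le {α : Type*} [MeasurableSpace α] (μ : Measure α) {f : α → ℝ≥0∞}
    (hf : AEMeasurable f μ) : (∫⁻ a, f a ∂μ) ^ 2 ≤ μ univ * ∫⁻ a, f a ^ 2 ∂μ := by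
  have h := ENNReal.lintegral_mul_le_Lp_mul_Lq μ (Real.HolderConjugate.two_two) hf
    (aemeasurable_const (b := (1 : ℝ≥0∞)))
  simp only [Pi.mul_apply, mul_one, ENNReal.one_rpow, lintegral_const, one_mul] at h
  have hs : ∀ a : ℝ≥0∞, (a ^ (1 / 2 : ℝ)) ^ 2 = a := fun a => by
    rw [← ENNReal.rpow_natCast, ← ENNReal.rpow_mul]; norm_num
  calc (∫⁻ a, f a ∂μ) ^ 2 ≤ _ := pow_le_pow_left' h 2
    _ = _ := by rw [mul_pow, hs, hs, mul_comm]; norm_cast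

/-- Cauchy-Schwarz with a weight `w`. -/
theorem sq_lintegral_mul_le {α : Type*} [MeasurableSpace α] (μ : Measure α) {w f : α → ℝ≥0∞}
    (hw : Measurable w) (hf : AEMeasurable f μ) :
    (∫⁻ a, w a * f a ∂μ) ^ 2 ≤ (∫⁻ a, w a ∂μ) * ∫⁻ a, w a * f a ^ 2 ∂μ := by
  have hac : AEMeasurable f (μ.withDensity w) := hf.mono_ac (withDensity_absolutelyContinuous μ w)
  have h := sq_lintegral_le (μ.withDensity w) hac
  rw [lintegral_withDensity_eq_lintegral_mul₀' hw.aemeasurable hac,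
    lintegral_withDensity_eq_lintegral_mul₀' hw.aemeasurable (hac.pow_const 2),
    withDensity_apply _ MeasurableSet.univ, setLIntegral_univ] at h
  exact h

section Convex

variable {E W : Type*} [NormedAddCommGroup E] [NormedSpace ℝ E]
  [NormedAddCommGroup W] [NormedSpace ℝ W]

/-- The fundamental theorem of calculus on a segment, combined with Cauchy-Schwarz. -/
theorem enorm_sub_sq_le_lintegral_fderiv [CompleteSpace W] {F : E → W} (hF : ContDiff ℝ 1 F)
    (x y : E) : ‖F y - F x‖ₑ ^ 2 ≤
      ‖y - x‖ₑ ^ 2 * ∫⁻ t in Ioc (0 : ℝ) 1, ‖fderiv ℝ F ((1 - t) • x + t • y)‖ₑ ^ 2 := by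
  have hc : Continuous fun t : ℝ => fderiv ℝ F ((1 - t) • x + t • y) :=
    (hF.continuous_fderiv one_ne_zero).comp (by fun_prop)
  have hd : ∀ t : ℝ, HasDerivAt (fun t : ℝ => F ((1 - t) • x + t • y))
      (fderiv ℝ F ((1 - t) • x + t • y) (y - x)) t := by
    intro t
    have h1 : HasDerivAt (fun t : ℝ => (1 - t) • x + t • y) (y - x) t := by
      have := (((hasDerivAt_id t).const_sub 1).smul_const x).add ((hasDerivAt_id t).smul_const y)
      convert this using 1
      · rfl
      · module
    exact ((hF.differentiable one_ne_zero _).hasFDerivAt).comp_hasDerivAt t h1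
  have hint := intervalIntegral.integral_eq_sub_of_hasDerivAt (fun t _ => hd t)
    ((hc.clm_apply continuous_const).intervalIntegrable 0 1)
  simp only [sub_zero, one_smul, zero_smul, add_zero, sub_self, zero_add] at hint
  rw [← hint, intervalIntegral.integral_of_le zero_le_one]
  calc _ ≤ (∫⁻ t in Ioc (0 : ℝ) 1, ‖fderiv ℝ F ((1 - t) • x + t • y) (y - x)‖ₑ) ^ 2 :=
        pow_le_pow_left' (enorm_integral_le_lintegral_enorm _) 2
    _ ≤ (∫⁻ t in Ioc (0 : ℝ) 1, ‖y - x‖ₑ * ‖fderiv ℝ F ((1 - t) • x + t • y)‖ₑ) ^ 2 := by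
        gcongr with t
        rw [mul_comm]
        exact ContinuousLinearMap.le_opENorm _ _
    _ = ‖y - x‖ₑ ^ 2 * (∫⁻ t in Ioc (0 : ℝ) 1, ‖fderiv ℝ F ((1 - t) • x + t • y)‖ₑ) ^ 2 := by
        rw [lintegral_const_mul' _ _ enorm_ne_top, mul_pow]
    _ ≤ _ := by
        gcongr
        refine (sq_lintegral_le _ (by fun_prop)).trans ?_
        simp

variable [FiniteDimensional ℝ E] [MeasurableSpace E] [BorelSpace E]
  (μ : Measure E) [μ.IsAddHaarMeasure]

/-- A contraction of a convex set towards one of its points, by a factor at least `1 / 2`,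
distorts integrals at most by the factor `2 ^ dim E`. -/
theorem setLIntegral_comp_homothety_le {S : Set E} (hS : Convex ℝ S) (hSm : MeasurableSet S)
    {K : E → ℝ≥0∞} (hK : Measurable K) {c : ℝ} (hc : 1 / 2 ≤ c) (hc1 : c ≤ 1) {y : E}
    (hy : y ∈ S) :
    ∫⁻ x in S, K (c • x + (1 - c) • y) ∂μ ≤ 2 ^ Module.finrank ℝ E * ∫⁻ x in S, K x ∂μ := by
  have hc0 : 0 < c := by linarith
  have hm : Measurable fun z => S.indicator K (z + (1 - c) • y) :=
    (hK.indicator hSm).comp (measurable_add_const _)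
  calc ∫⁻ x in S, K (c • x + (1 - c) • y) ∂μ
      = ∫⁻ x in S, S.indicator K (c • x + (1 - c) • y) ∂μ := by
        refine setLIntegral_congr_fun hSm fun x hx => ?_
        rw [indicator_of_mem (hS hx hy hc0.le (by linarith) (by ring))]
    _ ≤ ∫⁻ x, S.indicator K (c • x + (1 - c) • y) ∂μ := setLIntegral_le_lintegral _ _
    _ = ∫⁻ z, S.indicator K (z + (1 - c) • y) ∂(μ.map (c • ·)) :=
        (lintegral_map hm (measurable_const_smul c)).symm
    _ = ENNReal.ofReal |(c ^ Module.finrank ℝ E)⁻¹| * ∫⁻ x in S, K x ∂μ := by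
        rw [Measure.map_addHaar_smul μ hc0.ne', lintegral_smul_measure,
          lintegral_add_right_eq_self, lintegral_indicator hSm, smul_eq_mul]
    _ ≤ _ := by
        gcongr
        refine ENNReal.ofReal_le_of_le_toReal ?_
        rw [abs_of_pos (by positivity), ← inv_pow]
        simp only [ENNReal.toReal_pow, ENNReal.toReal_ofNat]
        gcongr
        rw [inv_le_comm₀ hc0 two_pos]
        linarith

/-- A Poincaré inequality on a convex set `S` of diameter at most `s`. The segment from `x` to
`y` is parametrized by `t ∈ [0, 1]`; for `t ≤ 1 / 2` the integral over `x`, and for `t ≥ 1 / 2`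
the integral over `y`, is transformed by a homothety. -/
theorem lintegral_prod_enorm_sub_sq_le [CompleteSpace W] {S : Set E} (hS : Convex ℝ S)
    (hSm : MeasurableSet S) {s : ℝ≥0∞} (hs : ∀ x ∈ S, ∀ y ∈ S, ‖y - x‖ₑ ≤ s)
    {F : E → W} (hF : ContDiff ℝ 1 F) :
    ∫⁻ p, ‖F p.2 - F p.1‖ₑ ^ 2 ∂((μ.restrict S).prod (μ.restrict S)) ≤
      s ^ 2 * (2 ^ Module.finrank ℝ E * μ S * ∫⁻ x in S, ‖fderiv ℝ F x‖ₑ ^ 2 ∂μ) := by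
  have hKc : Continuous fun x => fderiv ℝ F x := hF.continuous_fderiv one_ne_zero
  set K : E → ℝ≥0∞ := fun x => ‖fderiv ℝ F x‖ₑ ^ 2 with hKdef
  have hK : Measurable K := (by fun_prop : Continuous K).measurable
  have hcont : Continuous fun q : (E × E) × ℝ => K ((1 - q.2) • q.1.1 + q.2 • q.1.2) := by
    fun_prop
  calc ∫⁻ p, ‖F p.2 - F p.1‖ₑ ^ 2 ∂((μ.restrict S).prod (μ.restrict S))
      ≤ ∫⁻ p, s ^ 2 * (∫⁻ t in Ioc (0 : ℝ) 1, K ((1 - t) • p.1 + t • p.2))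
          ∂((μ.restrict S).prod (μ.restrict S)) := by
        rw [Measure.prod_restrict]
        refine lintegral_mono_ae ?_
        filter_upwards [ae_restrict_mem (hSm.prod hSm)] with p hp
        refine (enorm_sub_sq_le_lintegral_fderiv hF p.1 p.2).trans ?_
        gcongr
        exact hs _ hp.1 _ hp.2
    _ = s ^ 2 * ∫⁻ t in Ioc (0 : ℝ) 1, (∫⁻ p, K ((1 - t) • p.1 + t • p.2)
          ∂((μ.restrict S).prod (μ.restrict S))) := by
        rw [lintegral_const_mul, lintegral_lintegral_swap hcont.measurable.aemeasurable]
        exact hcont.measurable.lintegral_prod_right'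
    _ ≤ s ^ 2 * ∫⁻ t in Ioc (0 : ℝ) 1, 2 ^ Module.finrank ℝ E * μ S * ∫⁻ x in S, K x ∂μ := by
        refine mul_le_mul' le_rfl (setLIntegral_mono measurable_const fun t ht => ?_)
        have hct : Continuous fun p : E × E => K ((1 - t) • p.1 + t • p.2) := by fun_prop
        have hconst : ∫⁻ _ in S, 2 ^ Module.finrank ℝ E * ∫⁻ x in S, K x ∂μ ∂μ =
            2 ^ Module.finrank ℝ E * μ S * ∫⁻ x in S, K x ∂μ := by
          rw [setLIntegral_const]; ring
        rw [← hconst]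
        rcases le_total t (1 / 2) with h | h
        · rw [lintegral_prod_symm _ hct.measurable.aemeasurable]
          refine setLIntegral_mono measurable_const fun y hy => ?_
          have := setLIntegral_comp_homothety_le μ hS hSm hK (c := 1 - t) (by linarith)
            (by linarith [ht.1]) hy
          simpa using this
        · rw [lintegral_prod _ hct.measurable.aemeasurable]
          refine setLIntegral_mono measurable_const fun x hx => ?_
          have := setLIntegral_comp_homothety_le μ hS hSm hK (c := t) h ht.2 hx
          simpa [add_comm] using this
    _ = _ := by simp [hKdef]

end Convex

/-! ### Mollification and weak gradients -/

section Mollify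

variable {E W : Type*} [NormedAddCommGroup E] [NormedSpace ℝ E] [FiniteDimensional ℝ E]
  [MeasurableSpace E] [BorelSpace E] [NormedAddCommGroup W] [NormedSpace ℝ W]
  (μ : Measure E) [μ.IsAddHaarMeasure]

theorem lintegral_enorm_normed (φ : ContDiffBump (0 : E)) :
    ∫⁻ x, ‖φ.normed μ x‖ₑ ∂μ = 1 := by
  rw [← ofReal_integral_norm_eq_lintegral_enorm φ.integrable_normed]
  have : ∀ x, ‖φ.normed μ x‖ = φ.normed μ x := fun x => Real.norm_of_nonneg (φ.nonneg_normed x)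
  simp [this, φ.integral_normed]

/-- Mollification does not increase the `L²` norm. -/
theorem lintegral_enorm_convolution_sq_le (φ : ContDiffBump (0 : E)) {G : E → W}
    (hG : StronglyMeasurable G) :
    ∫⁻ x, ‖(φ.normed μ ⋆[lsmul ℝ ℝ, μ] G) x‖ₑ ^ 2 ∂μ ≤ ∫⁻ x, ‖G x‖ₑ ^ 2 ∂μ := by
  have hφ : Continuous (φ.normed μ) := φ.continuous_normed
  have hm : Measurable fun p : E × E => ‖φ.normed μ (p.1 - p.2)‖ₑ * ‖G p.2‖ₑ ^ 2 := by
    refine Measurable.mul (hφ.comp continuous_sub).measurable.enorm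
      ((hG.enorm.comp measurable_snd).pow_const 2)
  calc ∫⁻ x, ‖(φ.normed μ ⋆[lsmul ℝ ℝ, μ] G) x‖ₑ ^ 2 ∂μ
      ≤ ∫⁻ x, ∫⁻ y, ‖φ.normed μ (x - y)‖ₑ * ‖G y‖ₑ ^ 2 ∂μ ∂μ := by
        refine lintegral_mono fun x => ?_
        rw [convolution_eq_swap]
        calc _ ≤ (∫⁻ y, ‖φ.normed μ (x - y)‖ₑ * ‖G y‖ₑ ∂μ) ^ 2 := by
              refine pow_le_pow_left' ((enorm_integral_le_lintegral_enorm _).trans ?_) 2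
              simp only [lsmul_apply, enorm_smul, le_refl]
          _ ≤ _ := sq_lintegral_mul_le μ
              (hφ.comp (continuous_const.sub continuous_id)).measurable.enorm hG.enorm.aemeasurable
          _ = _ := by
              rw [lintegral_sub_left_eq_self (fun y => ‖φ.normed μ y‖ₑ), lintegral_enorm_normed,
                one_mul]
    _ = ∫⁻ y, ∫⁻ x, ‖φ.normed μ (x - y)‖ₑ * ‖G y‖ₑ ^ 2 ∂μ ∂μ :=
        lintegral_lintegral_swap hm.aemeasurable
    _ = ∫⁻ x, ‖G x‖ₑ ^ 2 ∂μ := by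
        refine lintegral_congr fun y => ?_
        have hmy : Measurable fun x => ‖φ.normed μ (x - y)‖ₑ :=
          (hφ.comp (continuous_id.sub continuous_const)).measurable.enorm
        rw [lintegral_mul_const _ hmy,
          lintegral_sub_right_eq_self (fun y => ‖φ.normed μ y‖ₑ), lintegral_enorm_normed, one_mul]

end Mollify

/-- The operator norm is bounded by the Euclidean norm of the values on the standard basis. -/
theorem opNorm_sq_le_sum {d : ℕ} {W : Type*} [NormedAddCommGroup W] [NormedSpace ℝ W]
    {T : EuclideanSpace ℝ (Fin d) →L[ℝ] W} {w : Fin d → W}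
    (hT : ∀ i, T (EuclideanSpace.single i 1) = w i) : ‖T‖ₑ ^ 2 ≤ ∑ i, ‖w i‖ₑ ^ 2 := by
  have h : ‖T‖ ≤ √(∑ i, ‖w i‖ ^ 2) := by
    refine T.opNorm_le_bound (Real.sqrt_nonneg _) fun v => ?_
    have hv : T v = ∑ i, v i • w i := by
      conv_lhs => rw [← (EuclideanSpace.basisFun (Fin d) ℝ).sum_repr v]
      simp [hT]
    rw [hv, EuclideanSpace.norm_eq, mul_comm]
    refine (norm_sum_le _ _).trans ?_
    simp only [norm_smul]
    exact Real.sum_mul_le_sqrt_mul_sqrt _ _ _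
  have h2 : ‖T‖ ^ 2 ≤ ∑ i, ‖w i‖ ^ 2 := by
    refine (pow_le_pow_left₀ (norm_nonneg _) h 2).trans ?_
    rw [Real.sq_sqrt (by positivity)]
  have he : ∀ {V : Type _} [NormedAddCommGroup V] (v : V), ‖v‖ₑ ^ 2 = ENNReal.ofReal (‖v‖ ^ 2) :=
    fun v => by rw [← ofReal_norm, ENNReal.ofReal_pow (norm_nonneg _)]
  rw [he]
  simp only [he]
  rw [← ENNReal.ofReal_sum_of_nonneg fun _ _ => by positivity]
  exact ENNReal.ofReal_le_ofReal h2

section Ball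

variable {d m : ℕ}

/-- The extension of an `L²` function on the ball to `ℝ^d` by zero. -/
def extend (u : L2 d m) : EuclideanSpace ℝ (Fin d) → EuclideanSpace ℂ (Fin m) :=
  (unitBall d).indicator u

theorem measurableSet_unitBall : MeasurableSet (unitBall d) := Metric.isOpen_ball.measurableSet

theorem stronglyMeasurable_extend (u : L2 d m) : StronglyMeasurable (extend u) :=
  (Lp.stronglyMeasurable u).indicator measurableSet_unitBall

theorem integrable_extend (u : L2 d m) : Integrable (extend u) :=
  IntegrableOn.integrable_indicator ((Lp.memLp u).integrable (by norm_num)) measurableSet_unitBall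

theorem lintegral_enorm_sq_eq (u : L2 d m) :
    ∫⁻ x, ‖u x‖ₑ ^ 2 ∂(ballMeasure d) = ‖u‖ₑ ^ 2 := by
  have h := eLpNorm_nnreal_pow_eq_lintegral (f := u) (μ := ballMeasure d) (p := 2) two_ne_zero
  rw [Lp.enorm_def]
  simp only [NNReal.coe_ofNat, ENNReal.rpow_ofNat] at h
  exact h.symm

theorem lintegral_enorm_extend_sq (u : L2 d m) :
    ∫⁻ x, ‖extend u x‖ₑ ^ 2 = ‖u‖ₑ ^ 2 := by
  rw [← lintegral_enorm_sq_eq]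
  change _ = ∫⁻ x in unitBall d, ‖u x‖ₑ ^ 2
  rw [← lintegral_indicator measurableSet_unitBall]
  refine lintegral_congr fun x => ?_
  by_cases hx : x ∈ unitBall d <;> simp [extend, hx]

/-- `g` is the weak gradient of `u` on the unit ball, its `i`-th component being the weak
derivative `∂_i u`. -/
def IsWeakGradient (u : L2 d m) (g : Fin d → L2 d m) : Prop :=
  ∀ i, ∀ φ : EuclideanSpace ℝ (Fin d) → ℝ, IsTest φ →
    ∫ x, partialDeriv i φ x • u x ∂(ballMeasure d) = -∫ x, φ x • g i x ∂(ballMeasure d)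

theorem integral_smul_extend (ψ : EuclideanSpace ℝ (Fin d) → ℝ) (u : L2 d m) :
    ∫ y, ψ y • extend u y = ∫ y, ψ y • u y ∂(ballMeasure d) := by
  change _ = ∫ y in unitBall d, ψ y • u y
  rw [← integral_indicator measurableSet_unitBall]
  congr 1
  ext1 x
  by_cases hx : x ∈ unitBall d <;> simp [extend, hx]

/-- At points at distance more than `φ.rOut` from the boundary, the translated and reflected
mollifier is a test function on the ball. -/
theorem isTest_normed_sub (φ : ContDiffBump (0 : EuclideanSpace ℝ (Fin d)))
    {x : EuclideanSpace ℝ (Fin d)} (hx : ‖x‖ < 1 - φ.rOut) :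
    IsTest fun y => φ.normed volume (x - y) := by
  have hsub : tsupport (fun y => φ.normed volume (x - y)) ⊆ Metric.closedBall x φ.rOut := by
    refine closure_minimal (fun y hy => ?_) Metric.isClosed_closedBall
    have : x - y ∈ Function.support (φ.normed volume) := hy
    rw [φ.support_normed_eq] at this
    rw [Metric.mem_closedBall, dist_comm, dist_eq_norm]
    simpa using (mem_ball_zero_iff.mp this).le
  refine ⟨φ.contDiff_normed.comp (contDiff_const.sub contDiff_id), ?_, fun y hy => ?_⟩
  · exact HasCompactSupport.of_support_subset_isCompact (isCompact_closedBall x φ.rOut)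
      (subset_closure.trans hsub)
  · have h := hsub hy
    rw [Metric.mem_closedBall, dist_eq_norm] at h
    rw [unitBall, mem_ball_zero_iff]
    calc ‖y‖ = ‖x + (y - x)‖ := by congr 1; abel
      _ ≤ ‖x‖ + ‖y - x‖ := norm_add_le _ _
      _ < 1 := by linarith

/-- Mollification commutes with weak differentiation away from the boundary of the ball. -/
theorem fderiv_convolution_apply_single (φ : ContDiffBump (0 : EuclideanSpace ℝ (Fin d)))
    {u : L2 d m} {g : Fin d → L2 d m} (hg : IsWeakGradient u g)
    {x : EuclideanSpace ℝ (Fin d)} (hx : ‖x‖ < 1 - φ.rOut) (i : Fin d) :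
    fderiv ℝ (φ.normed volume ⋆[lsmul ℝ ℝ, volume] extend u) x (EuclideanSpace.single i 1) =
      (φ.normed volume ⋆[lsmul ℝ ℝ, volume] extend (g i)) x := by
  set e : EuclideanSpace ℝ (Fin d) := EuclideanSpace.single i 1
  have hφ1 : ContDiff ℝ 1 (φ.normed volume) := φ.contDiff_normed
  have hcs : HasCompactSupport (φ.normed volume) := φ.hasCompactSupport_normed
  have hloc := (integrable_extend u).locallyIntegrable
  have hex : ConvolutionExistsAt (fderiv ℝ (φ.normed volume)) (extend u) x
      ((lsmul ℝ ℝ).precompL (EuclideanSpace ℝ (Fin d))) volume :=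
    (hcs.fderiv ℝ).convolutionExists_left _ (hφ1.continuous_fderiv one_ne_zero) hloc x
  have hpd : ∀ y, partialDeriv i (fun y => φ.normed volume (x - y)) y =
      -(fderiv ℝ (φ.normed volume) (x - y) e) := by
    intro y
    have h1 : HasFDerivAt (fun y => φ.normed volume (x - y))
        ((fderiv ℝ (φ.normed volume) (x - y)).comp
          (-ContinuousLinearMap.id ℝ (EuclideanSpace ℝ (Fin d)))) y :=
      ((hφ1.differentiable one_ne_zero _).hasFDerivAt).comp y ((hasFDerivAt_id y).const_sub x)
    rw [partialDeriv, h1.fderiv]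
    simp [e]
  rw [(hcs.hasFDerivAt_convolution_left (lsmul ℝ ℝ) hφ1 hloc x).fderiv, convolution,
    ContinuousLinearMap.integral_apply hex, convolution_eq_swap]
  simp only [lsmul_apply]
  rw [integral_smul_extend, ← neg_neg (∫ y, _ ∂(ballMeasure d)),
    ← hg i _ (isTest_normed_sub φ hx), ← integral_smul_extend,
    ← integral_sub_left_eq_self _ volume x, ← integral_neg]
  refine integral_congr_ae (.of_forall fun y => ?_)
  simp [hpd, ContinuousLinearMap.precompL_apply]

theorem contDiff_mollify (φ : ContDiffBump (0 : EuclideanSpace ℝ (Fin d))) (u : L2 d m) :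
    ContDiff ℝ 1 (φ.normed volume ⋆[lsmul ℝ ℝ, volume] extend u) :=
  φ.hasCompactSupport_normed.contDiff_convolution_left _ φ.contDiff_normed
    (integrable_extend u).locallyIntegrable

end Ball

/-! ### Mean oscillation and a partition of the ball -/

theorem add_sq_le_two_mul (a b : ℝ≥0∞) : (a + b) ^ 2 ≤ 2 * (a ^ 2 + b ^ 2) := by
  have h := ENNReal.rpow_add_le_mul_rpow_add_rpow a b (p := 2) (by norm_num)
  norm_num at h
  exact h

/-- The second moment is bounded by the mean and the mean square oscillation. -/
theorem lintegral_enorm_sq_le_oscillation {α W : Type*} [MeasurableSpace α] [NormedAddCommGroup W]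
    [NormedSpace ℝ W] [CompleteSpace W] (μ : Measure α) [IsFiniteMeasure μ] {f : α → W}
    (hfm : StronglyMeasurable f) (hf : Integrable f μ) :
    ∫⁻ x, ‖f x‖ₑ ^ 2 ∂μ ≤
      2 * ((μ univ)⁻¹ * ∫⁻ p, ‖f p.2 - f p.1‖ₑ ^ 2 ∂(μ.prod μ)) +
        (μ univ)⁻¹ * (2 * ‖∫ x, f x ∂μ‖ₑ ^ 2) := by
  rcases eq_or_ne (μ univ) 0 with h0 | h0
  · simp [Measure.measure_univ_eq_zero.mp h0]
  set q := μ univ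
  have hqt : q ≠ ⊤ := measure_ne_top μ univ
  have hm : Measurable fun p : α × α => ‖f p.2 - f p.1‖ₑ ^ 2 :=
    ((hfm.comp_measurable measurable_snd).sub
      (hfm.comp_measurable measurable_fst)).enorm.pow_const 2
  have hpt : ∀ x, q ^ 2 * ‖f x‖ₑ ^ 2 ≤
      2 * (q * ∫⁻ y, ‖f y - f x‖ₑ ^ 2 ∂μ + ‖∫ y, f y ∂μ‖ₑ ^ 2) := by
    intro x
    have h1 : μ.real univ • f x = -(∫ y, (f y - f x) ∂μ) + ∫ y, f y ∂μ := by
      rw [integral_sub hf (integrable_const _), integral_const]; abel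
    have h2 : q * ‖f x‖ₑ ≤ ∫⁻ y, ‖f y - f x‖ₑ ∂μ + ‖∫ y, f y ∂μ‖ₑ := by
      calc q * ‖f x‖ₑ = ‖μ.real univ • f x‖ₑ := by
            rw [enorm_smul, Real.enorm_of_nonneg measureReal_nonneg, ofReal_measureReal]
        _ ≤ _ := by
            rw [h1]
            refine (enorm_add_le _ _).trans ?_
            rw [enorm_neg]
            gcongr
            exact enorm_integral_le_lintegral_enorm _
    rw [← mul_pow]
    refine (pow_le_pow_left' h2 2).trans ((add_sq_le_two_mul _ _).trans ?_)
    gcongr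
    exact sq_lintegral_le μ (hfm.sub stronglyMeasurable_const).enorm.aemeasurable
  have hint : q ^ 2 * ∫⁻ x, ‖f x‖ₑ ^ 2 ∂μ ≤
      q * (2 * ∫⁻ p, ‖f p.2 - f p.1‖ₑ ^ 2 ∂(μ.prod μ) + 2 * ‖∫ y, f y ∂μ‖ₑ ^ 2) := by
    rw [← lintegral_const_mul _ (hfm.enorm.pow_const 2)]
    refine (lintegral_mono hpt).trans (le_of_eq ?_)
    rw [lintegral_const_mul' _ _ (by norm_num), lintegral_add_right _ measurable_const,
      lintegral_const_mul' _ _ hqt, lintegral_const, lintegral_prod _ hm.aemeasurable]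
    ring
  calc ∫⁻ x, ‖f x‖ₑ ^ 2 ∂μ = q⁻¹ ^ 2 * (q ^ 2 * ∫⁻ x, ‖f x‖ₑ ^ 2 ∂μ) := by
        rw [← mul_assoc, ← mul_pow, ENNReal.inv_mul_cancel h0 hqt, one_pow, one_mul]
    _ ≤ q⁻¹ ^ 2 * (q * (2 * ∫⁻ p, ‖f p.2 - f p.1‖ₑ ^ 2 ∂(μ.prod μ) +
          2 * ‖∫ y, f y ∂μ‖ₑ ^ 2)) := by gcongr
    _ = (q⁻¹ * q) * (q⁻¹ * (2 * ∫⁻ p, ‖f p.2 - f p.1‖ₑ ^ 2 ∂(μ.prod μ) +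
          2 * ‖∫ y, f y ∂μ‖ₑ ^ 2)) := by ring
    _ = _ := by rw [ENNReal.inv_mul_cancel h0 hqt]; ring

variable {d m : ℕ}

/-- The ball is cut by a grid of small cubes. -/
theorem exists_convex_partition (d : ℕ) {s : ℝ} (hs : 0 < s) :
    ∃ (ι : Type) (_ : Fintype ι) (Q : ι → Set (EuclideanSpace ℝ (Fin d))),
      (∀ n, Convex ℝ (Q n)) ∧ (∀ n, MeasurableSet (Q n)) ∧ Pairwise (Function.onFun Disjoint Q) ∧
      (⋃ n, Q n) = unitBall d ∧ ∀ n, ∀ x ∈ Q n, ∀ y ∈ Q n, ‖y - x‖ ≤ s := by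
  set h : ℝ := s / (d + 1) with hh
  have h0 : 0 < h := by positivity
  set M : ℤ := ⌈1 / h⌉
  let I : Finset (Fin d → ℤ) := Fintype.piFinset fun _ => Finset.Icc (-M) M
  let Q : I → Set (EuclideanSpace ℝ (Fin d)) := fun z =>
    unitBall d ∩ ⋂ i, {x | (z.1 i : ℝ) * h ≤ x i ∧ x i < (z.1 i + 1) * h}
  have hfl : ∀ (z : ℤ) (t : ℝ), (z * h ≤ t ∧ t < (z + 1) * h) ↔ ⌊t / h⌋ = z := fun z t => by
    rw [Int.floor_eq_iff, le_div_iff₀ h0, div_lt_iff₀ h0]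
  have hproj : ∀ i, IsLinearMap ℝ fun x : EuclideanSpace ℝ (Fin d) => x i := fun i =>
    ⟨fun _ _ => rfl, fun _ _ => rfl⟩
  have hmeas : ∀ i, Measurable fun x : EuclideanSpace ℝ (Fin d) => x i := fun i =>
    (by fun_prop : Continuous fun x : EuclideanSpace ℝ (Fin d) => x i).measurable
  refine ⟨I, inferInstance, Q, fun z => ?_, fun z => ?_, fun z w hzw => ?_, ?_, ?_⟩
  · refine (convex_ball _ _).inter (convex_iInter fun i => ?_)
    exact (convex_halfSpace_ge (hproj i) _).inter (convex_halfSpace_lt (hproj i) _)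
  · refine measurableSet_unitBall.inter (MeasurableSet.iInter fun i => ?_)
    exact (measurableSet_le measurable_const (hmeas i)).inter
      (measurableSet_lt (hmeas i) measurable_const)
  · refine Set.disjoint_left.mpr fun x hx hx' => hzw (Subtype.ext (funext fun i => ?_))
    have h1 := (hfl _ _).mp (mem_iInter.mp hx.2 i)
    have h2 := (hfl _ _).mp (mem_iInter.mp hx'.2 i)
    exact h1.symm.trans h2
  · refine Subset.antisymm (iUnion_subset fun _ => inter_subset_left) fun x hx => ?_
    have hI : (fun i => ⌊x i / h⌋) ∈ I := by
      refine Fintype.mem_piFinset.mpr fun i => Finset.mem_Icc.mpr ?_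
      have hx1 : |x i| ≤ 1 := by
        have := (PiLp.norm_apply_le x i).trans (mem_ball_zero_iff.mp hx).le
        simpa using this
      have hM : 1 / h ≤ M := Int.le_ceil _
      have hb := abs_le.mp hx1
      have h1 : x i / h ≤ 1 / h := by gcongr; exact hb.2
      have h2 : -(1 / h) ≤ x i / h := by rw [← neg_div]; gcongr; exact hb.1
      refine ⟨Int.le_floor.mpr ?_, ?_⟩
      · push_cast; linarith
      · have : (⌊x i / h⌋ : ℝ) ≤ M := (Int.floor_le _).trans (by linarith)
        exact_mod_cast this
    exact mem_iUnion.mpr ⟨⟨_, hI⟩, hx, mem_iInter.mpr fun i => (hfl _ _).mpr rfl⟩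
  · intro z x hx y hy
    rw [EuclideanSpace.norm_eq]
    refine Real.sqrt_le_iff.mpr ⟨hs.le, ?_⟩
    calc ∑ i, ‖(y - x) i‖ ^ 2 ≤ ∑ _i : Fin d, h ^ 2 := by
          refine Finset.sum_le_sum fun i _ => pow_le_pow_left₀ (norm_nonneg _) ?_ 2
          have h1 := mem_iInter.mp hx.2 i
          have h2 := mem_iInter.mp hy.2 i
          simp only [mem_ofPred_eq] at h1 h2
          rw [PiLp.sub_apply, Real.norm_eq_abs, abs_le]
          constructor <;> nlinarith
      _ = d * h ^ 2 := by simp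
      _ ≤ (d + 1) ^ 2 * h ^ 2 := by gcongr; nlinarith [(Nat.cast_nonneg d : (0 : ℝ) ≤ d)]
      _ = s ^ 2 := by rw [hh]; field_simp

/-! ### Control of `L²` by the weak gradient and finitely many functionals -/

section Oscillation

variable {ι : Type*} [Fintype ι] {Q : ι → Set (EuclideanSpace ℝ (Fin d))}

/-- The oscillation estimate for the mollified functions, on the part of the ball where
mollification commutes with weak differentiation. -/
theorem sum_oscillation_mollify_le (hQc : ∀ n, Convex ℝ (Q n)) (hQm : ∀ n, MeasurableSet (Q n))
    (hQd : Pairwise (Function.onFun Disjoint Q)) {s : ℝ≥0∞}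
    (hs : ∀ n, ∀ x ∈ Q n, ∀ y ∈ Q n, ‖y - x‖ₑ ≤ s)
    {u : L2 d m} {g : Fin d → L2 d m} (hg : IsWeakGradient u g)
    (φ : ContDiffBump (0 : EuclideanSpace ℝ (Fin d))) :
    ∑ n, (volume (Q n))⁻¹ * ∫⁻ p,
        (Metric.ball (0 : EuclideanSpace ℝ (Fin d)) (1 - φ.rOut) ×ˢ
          Metric.ball (0 : EuclideanSpace ℝ (Fin d)) (1 - φ.rOut)).indicator
        (fun p => ‖(φ.normed volume ⋆[lsmul ℝ ℝ, volume] extend u) p.2 -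
          (φ.normed volume ⋆[lsmul ℝ ℝ, volume] extend u) p.1‖ₑ ^ 2) p
        ∂((volume.restrict (Q n)).prod (volume.restrict (Q n))) ≤
      s ^ 2 * 2 ^ d * ∑ i, ‖g i‖ₑ ^ 2 := by
  set A := Metric.ball (0 : EuclideanSpace ℝ (Fin d)) (1 - φ.rOut)
  set U := φ.normed volume ⋆[lsmul ℝ ℝ, volume] extend u
  have hAm : MeasurableSet A := Metric.isOpen_ball.measurableSet
  have hU : ContDiff ℝ 1 U := contDiff_mollify φ u
  have hone : ∀ n, (volume (Q n))⁻¹ * ∫⁻ p, (A ×ˢ A).indicator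
        (fun p => ‖U p.2 - U p.1‖ₑ ^ 2) p
        ∂((volume.restrict (Q n)).prod (volume.restrict (Q n))) ≤
      s ^ 2 * 2 ^ d * ∫⁻ x in A ∩ Q n, ‖fderiv ℝ U x‖ₑ ^ 2 := by
    intro n
    rw [lintegral_indicator (hAm.prod hAm), ← Measure.prod_restrict,
      Measure.restrict_restrict hAm]
    have h := lintegral_prod_enorm_sub_sq_le volume ((convex_ball _ _).inter (hQc n))
      (hAm.inter (hQm n)) (fun x hx y hy => hs n x hx.2 y hy.2) hU
    rw [finrank_euclideanSpace_fin] at h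
    refine (mul_le_mul' le_rfl h).trans ?_
    calc (volume (Q n))⁻¹ * (s ^ 2 * (2 ^ d * volume (A ∩ Q n) *
          ∫⁻ x in A ∩ Q n, ‖fderiv ℝ U x‖ₑ ^ 2))
        ≤ (volume (Q n))⁻¹ * (s ^ 2 * (2 ^ d * volume (Q n) *
          ∫⁻ x in A ∩ Q n, ‖fderiv ℝ U x‖ₑ ^ 2)) := by gcongr; exact inter_subset_right
      _ = ((volume (Q n))⁻¹ * volume (Q n)) *
          (s ^ 2 * 2 ^ d * ∫⁻ x in A ∩ Q n, ‖fderiv ℝ U x‖ₑ ^ 2) := by ring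
      _ ≤ 1 * _ := by gcongr; exact ENNReal.inv_mul_le_one _
      _ = _ := one_mul _
  refine (Finset.sum_le_sum fun n _ => hone n).trans ?_
  rw [← Finset.mul_sum]
  gcongr
  have hdisj : Pairwise (Function.onFun Disjoint fun n => A ∩ Q n) := fun a b hab =>
    (hQd hab).mono inter_subset_right inter_subset_right
  calc ∑ n, ∫⁻ x in A ∩ Q n, ‖fderiv ℝ U x‖ₑ ^ 2
      = ∫⁻ x in ⋃ n, A ∩ Q n, ‖fderiv ℝ U x‖ₑ ^ 2 := by
        rw [lintegral_iUnion (fun n => hAm.inter (hQm n)) hdisj, tsum_fintype]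
    _ ≤ ∫⁻ x in A, ‖fderiv ℝ U x‖ₑ ^ 2 :=
        lintegral_mono_set (iUnion_subset fun n => inter_subset_left)
    _ ≤ ∫⁻ x in A, ∑ i, ‖(φ.normed volume ⋆[lsmul ℝ ℝ, volume] extend (g i)) x‖ₑ ^ 2 := by
        refine setLIntegral_mono' hAm fun x hx => opNorm_sq_le_sum fun i => ?_
        exact fderiv_convolution_apply_single φ hg (mem_ball_zero_iff.mp hx) i
    _ ≤ ∫⁻ x, ∑ i, ‖(φ.normed volume ⋆[lsmul ℝ ℝ, volume] extend (g i)) x‖ₑ ^ 2 :=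
        setLIntegral_le_lintegral _ _
    _ = ∑ i, ∫⁻ x, ‖(φ.normed volume ⋆[lsmul ℝ ℝ, volume] extend (g i)) x‖ₑ ^ 2 :=
        lintegral_finsetSum _ fun i _ =>
          (contDiff_mollify φ (g i)).continuous.enorm.measurable.pow_const 2
    _ ≤ ∑ i, ‖g i‖ₑ ^ 2 := by
        refine Finset.sum_le_sum fun i _ => ?_
        rw [← lintegral_enorm_extend_sq]
        exact lintegral_enorm_convolution_sq_le volume φ (stronglyMeasurable_extend _)

/-- The oscillation estimate for functions with a weak gradient: Fatou's lemma along a sequence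
of mollifications, with respect to the sum of the measures on the squares of the cells. -/
theorem sum_oscillation_le (hQc : ∀ n, Convex ℝ (Q n)) (hQm : ∀ n, MeasurableSet (Q n))
    (hQd : Pairwise (Function.onFun Disjoint Q)) (hQb : ∀ n, Q n ⊆ unitBall d) {s : ℝ≥0∞}
    (hs : ∀ n, ∀ x ∈ Q n, ∀ y ∈ Q n, ‖y - x‖ₑ ≤ s)
    {u : L2 d m} {g : Fin d → L2 d m} (hg : IsWeakGradient u g) :
    ∑ n, (volume (Q n))⁻¹ * ∫⁻ p, ‖extend u p.2 - extend u p.1‖ₑ ^ 2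
        ∂((volume.restrict (Q n)).prod (volume.restrict (Q n))) ≤
      s ^ 2 * 2 ^ d * ∑ i, ‖g i‖ₑ ^ 2 := by
  -- Shrinking radii with a bounded ratio, as needed for convergence almost everywhere.
  let φ : ℕ → ContDiffBump (0 : EuclideanSpace ℝ (Fin d)) := fun k =>
    { rIn := 1 / (k + 1 : ℝ) / 2
      rOut := 1 / (k + 1 : ℝ)
      rIn_pos := by positivity
      rIn_lt_rOut := half_lt_self (by positivity) }
  have hφ : Tendsto (fun k => (φ k).rOut) atTop (𝓝 0) := tendsto_one_div_add_atTop_nhds_zero_nat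
  let A : ℕ → Set (EuclideanSpace ℝ (Fin d)) := fun k => Metric.ball 0 (1 - (φ k).rOut)
  let U : ℕ → EuclideanSpace ℝ (Fin d) → EuclideanSpace ℂ (Fin m) := fun k =>
    (φ k).normed volume ⋆[lsmul ℝ ℝ, volume] extend u
  let G : ℕ → EuclideanSpace ℝ (Fin d) × EuclideanSpace ℝ (Fin d) → ℝ≥0∞ := fun k =>
    (A k ×ˢ A k).indicator fun p => ‖U k p.2 - U k p.1‖ₑ ^ 2
  let ν : Measure (EuclideanSpace ℝ (Fin d) × EuclideanSpace ℝ (Fin d)) :=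
    ∑ n, (volume (Q n))⁻¹ • (volume.restrict (Q n)).prod (volume.restrict (Q n))
  have hν : ∀ F : EuclideanSpace ℝ (Fin d) × EuclideanSpace ℝ (Fin d) → ℝ≥0∞,
      ∫⁻ p, F p ∂ν = ∑ n, (volume (Q n))⁻¹ *
        ∫⁻ p, F p ∂((volume.restrict (Q n)).prod (volume.restrict (Q n))) := fun F => by
    simp only [ν, lintegral_finsetSum_measure, lintegral_smul_measure, smul_eq_mul]
  have hGm : ∀ k, Measurable (G k) := fun k => by
    have hc : Continuous (U k) := (contDiff_mollify (φ k) u).continuous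
    refine Measurable.indicator ?_
      (Metric.isOpen_ball.measurableSet.prod Metric.isOpen_ball.measurableSet)
    exact ((hc.comp continuous_snd).sub (hc.comp continuous_fst)).enorm.measurable.pow_const 2
  have hae : ∀ᵐ x : EuclideanSpace ℝ (Fin d),
      Tendsto (fun k => U k x) atTop (𝓝 (extend u x)) :=
    ContDiffBump.ae_convolution_tendsto_right_of_locallyIntegrable (K := 2) hφ
      (.of_forall fun k => by simp only [φ]; linarith) (integrable_extend u).locallyIntegrable
  have hev : ∀ x ∈ unitBall d, ∀ᶠ k in atTop, x ∈ A k := fun x hx => by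
    have h1 : Tendsto (fun k => 1 - (φ k).rOut) atTop (𝓝 (1 - 0)) := hφ.const_sub 1
    rw [sub_zero] at h1
    filter_upwards [h1.eventually (lt_mem_nhds (mem_ball_zero_iff.mp hx))] with k hk
    exact mem_ball_zero_iff.mpr hk
  have hlim : ∀ n, ∀ᵐ p ∂((volume.restrict (Q n)).prod (volume.restrict (Q n))),
      Tendsto (fun k => G k p) atTop (𝓝 (‖extend u p.2 - extend u p.1‖ₑ ^ 2)) := by
    intro n
    have hx : ∀ᵐ x ∂(volume.restrict (Q n)), x ∈ unitBall d ∧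
        Tendsto (fun k => U k x) atTop (𝓝 (extend u x)) := by
      filter_upwards [ae_restrict_mem (hQm n), ae_restrict_of_ae hae] with x h1 h2
      exact ⟨hQb n h1, h2⟩
    filter_upwards [Measure.quasiMeasurePreserving_fst.ae hx,
      Measure.quasiMeasurePreserving_snd.ae hx] with p h1 h2
    refine Tendsto.congr' ?_ (ENNReal.Tendsto.pow (h2.2.sub h1.2).enorm)
    filter_upwards [hev _ h1.1, hev _ h2.1] with k hk1 hk2
    have hk : p ∈ A k ×ˢ A k := ⟨hk1, hk2⟩
    simp only [G, indicator_of_mem hk]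
  calc _ ≤ ∫⁻ p, liminf (fun k => G k p) atTop ∂ν := by
        rw [hν]
        refine Finset.sum_le_sum fun n _ => mul_le_mul' le_rfl (lintegral_mono_ae ?_)
        filter_upwards [hlim n] with p hp
        exact hp.liminf_eq.ge
    _ ≤ liminf (fun k => ∫⁻ p, G k p ∂ν) atTop := lintegral_liminf_le hGm
    _ ≤ s ^ 2 * 2 ^ d * ∑ i, ‖g i‖ₑ ^ 2 := by
        refine liminf_le_of_frequently_le' (Frequently.of_forall fun k => ?_)
        rw [hν]
        exact sum_oscillation_mollify_le hQc hQm hQd hs hg (φ k)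

end Oscillation

/-- The integral over `Q` in terms of its coordinates, each of which is an inner product in
`L²`. -/
theorem norm_setIntegral_sq_eq {Q : Set (EuclideanSpace ℝ (Fin d))} (hQm : MeasurableSet Q)
    (u : L2 d m) (hQ : ballMeasure d Q ≠ ⊤) :
    ∑ j, ‖inner ℂ (indicatorConstLp 2 hQm hQ (EuclideanSpace.single j (1 : ℂ))) u‖ ^ 2 =
      ‖∫ x in Q, u x ∂(ballMeasure d)‖ ^ 2 := by
  have hi : Integrable u ((ballMeasure d).restrict Q) :=
    ((Lp.memLp u).integrable (by norm_num)).integrableOn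
  rw [EuclideanSpace.norm_sq_eq]
  refine Finset.sum_congr rfl fun j _ => ?_
  rw [L2.inner_indicatorConstLp_eq_inner_setIntegral, EuclideanSpace.inner_single_left]
  simp

/-- A weak form of the compactness of `H¹ ⊆ L²`: up to finitely many continuous functionals, the
`L²` norm is bounded by an arbitrarily small multiple of the norm of the weak gradient. -/
theorem exists_functionals_norm_sq_le (d m : ℕ) {δ : ℝ} (hδ : 0 < δ) :
    ∃ (ι : Type) (_ : Fintype ι) (l : ι → L2 d m →L[ℂ] ℂ), ∀ (u : L2 d m) (g : Fin d → L2 d m),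
      IsWeakGradient u g → ‖u‖ ^ 2 ≤ δ * ∑ i, ‖g i‖ ^ 2 + ∑ n, ‖l n u‖ ^ 2 := by
  -- The factor `2` is that of the oscillation in the second moment, `2 ^ d` that of the
  -- homotheties in the Poincaré inequality.
  set s : ℝ := √(δ / (2 * 2 ^ d)) with hs
  have hs0 : 0 < s := by positivity
  obtain ⟨ι, _, Q, hQc, hQm, hQd, hQu, hQs⟩ := exists_convex_partition d hs0
  have hQb : ∀ n, Q n ⊆ unitBall d := fun n => hQu ▸ subset_iUnion Q n
  have hQt : ∀ n, ballMeasure d (Q n) ≠ ⊤ := fun n => measure_ne_top _ _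
  have hres : ∀ n, (ballMeasure d).restrict (Q n) = volume.restrict (Q n) := fun n => by
    rw [ballMeasure, Measure.restrict_restrict (hQm n), inter_eq_left.mpr (hQb n)]
  have hvt : ∀ n, volume (Q n) ≠ ⊤ := fun n =>
    ((measure_mono (hQb n)).trans_lt measure_ball_lt_top).ne
  refine ⟨ι × Fin m, inferInstance, fun n => ((√(2 / volume.real (Q n.1)) : ℝ) : ℂ) •
    innerSL ℂ (indicatorConstLp 2 (hQm n.1) (hQt n.1) (EuclideanSpace.single n.2 (1 : ℂ))),
    fun u g hg => ?_⟩
  have hl : ∀ n, ∑ j, ‖(((√(2 / volume.real (Q n)) : ℝ) : ℂ) • innerSL ℂ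
      (indicatorConstLp 2 (hQm n) (hQt n) (EuclideanSpace.single j (1 : ℂ)))) u‖ ^ 2 =
      2 / volume.real (Q n) * ‖∫ x in Q n, u x ∂(ballMeasure d)‖ ^ 2 := by
    intro n
    rw [← norm_setIntegral_sq_eq (hQm n) u (hQt n), Finset.mul_sum]
    refine Finset.sum_congr rfl fun j _ => ?_
    rw [_root_.smul_apply, norm_smul, mul_pow, Complex.norm_real, Real.norm_eq_abs,
      sq_abs, Real.sq_sqrt (by positivity), innerSL_apply_apply]
  rw [Fintype.sum_prod_type, Finset.sum_congr rfl fun n _ => hl n]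
  have he : ∀ {V : Type _} [NormedAddCommGroup V] (v : V), ‖v‖ₑ ^ 2 = ENNReal.ofReal (‖v‖ ^ 2) :=
    fun v => by rw [← ofReal_norm, ENNReal.ofReal_pow (norm_nonneg _)]
  have hue : ∀ n, ∫ x in Q n, extend u x = ∫ x in Q n, u x ∂(ballMeasure d) := fun n => by
    rw [hres]
    refine setIntegral_congr_fun (hQm n) fun x hx => ?_
    exact indicator_of_mem (hQb n hx) _
  have hmean : ∀ n, (volume (Q n))⁻¹ * (2 * ‖∫ x in Q n, u x ∂(ballMeasure d)‖ₑ ^ 2) ≤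
      ENNReal.ofReal (2 / volume.real (Q n) * ‖∫ x in Q n, u x ∂(ballMeasure d)‖ ^ 2) := by
    intro n
    rcases eq_or_ne (volume (Q n)) 0 with h0 | h0
    · -- Here the factor `(volume (Q n))⁻¹` is infinite, but the integral vanishes.
      rw [hres, Measure.restrict_eq_zero.mpr h0]
      simp
    · have hpos : 0 < volume.real (Q n) := ENNReal.toReal_pos h0 (hvt n)
      rw [he, div_eq_mul_inv, ENNReal.ofReal_mul (by positivity),
        ENNReal.ofReal_mul (by positivity), ENNReal.ofReal_inv_of_pos hpos,
        ofReal_measureReal (hvt n)]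
      refine le_of_eq ?_
      rw [ENNReal.ofReal_ofNat]
      ring
  have hmain : ‖u‖ₑ ^ 2 ≤ ENNReal.ofReal (δ * ∑ i, ‖g i‖ ^ 2 +
      ∑ n, 2 / volume.real (Q n) * ‖∫ x in Q n, u x ∂(ballMeasure d)‖ ^ 2) := by
    calc ‖u‖ₑ ^ 2 = ∑ n, ∫⁻ x in Q n, ‖extend u x‖ₑ ^ 2 := by
          rw [← lintegral_enorm_extend_sq, ← tsum_fintype (L := .unconditional _),
            ← lintegral_iUnion hQm hQd, hQu, ← lintegral_indicator measurableSet_unitBall]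
          refine lintegral_congr fun x => ?_
          by_cases hx : x ∈ unitBall d <;> simp [extend, hx]
      _ ≤ ∑ n, (2 * ((volume (Q n))⁻¹ * ∫⁻ p, ‖extend u p.2 - extend u p.1‖ₑ ^ 2
            ∂((volume.restrict (Q n)).prod (volume.restrict (Q n)))) +
            (volume (Q n))⁻¹ * (2 * ‖∫ x in Q n, u x ∂(ballMeasure d)‖ₑ ^ 2)) := by
          refine Finset.sum_le_sum fun n _ => ?_
          have : IsFiniteMeasure (volume.restrict (Q n)) :=
            isFiniteMeasure_restrict.mpr (hvt n)
          have h := lintegral_enorm_sq_le_oscillation (volume.restrict (Q n))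
            (stronglyMeasurable_extend u) (integrable_extend u).integrableOn
          rwa [Measure.restrict_apply_univ, hue] at h
      _ ≤ 2 * (ENNReal.ofReal s ^ 2 * 2 ^ d * ∑ i, ‖g i‖ₑ ^ 2) + ∑ n, ENNReal.ofReal
            (2 / volume.real (Q n) * ‖∫ x in Q n, u x ∂(ballMeasure d)‖ ^ 2) := by
          rw [Finset.sum_add_distrib, ← Finset.mul_sum]
          gcongr with n
          · refine sum_oscillation_le hQc hQm hQd hQb (fun n x hx y hy => ?_) hg
            rw [← ofReal_norm]
            exact ENNReal.ofReal_le_ofReal (hQs n x hx y hy)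
          · exact hmean n
      _ = _ := by
          rw [ENNReal.ofReal_add (by positivity) (by positivity),
            ENNReal.ofReal_sum_of_nonneg fun _ _ => by positivity, ENNReal.ofReal_mul hδ.le,
            ENNReal.ofReal_sum_of_nonneg fun _ _ => by positivity]
          have hδs : δ = 2 * (s ^ 2 * 2 ^ d) := by
            rw [hs, Real.sq_sqrt (by positivity)]; field_simp
          have hδe : ENNReal.ofReal δ = 2 * (ENNReal.ofReal s ^ 2 * 2 ^ d) := by
            rw [hδs, ENNReal.ofReal_mul zero_le_two, ENNReal.ofReal_mul (by positivity),
              ENNReal.ofReal_pow hs0.le, ENNReal.ofReal_pow zero_le_two, ENNReal.ofReal_ofNat]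
          rw [hδe]
          simp only [he]
          ring
  rw [he] at hmain
  exact (ENNReal.ofReal_le_ofReal_iff (by positivity)).mp hmain

end Poincare

/-! ### Functionals on an incomplete inner product space -/

section InnerProduct

open UniformSpace

/-- In a possibly incomplete inner product space, continuous functionals are limits of inner
products with vectors, since the space is dense in its completion. -/
theorem exists_norm_sub_inner_le {V : Type*} [NormedAddCommGroup V] [InnerProductSpace ℂ V]
    (l : V →L[ℂ] ℂ) {η : ℝ} (hη : 0 < η) : ∃ v : V, ∀ f : V, ‖l f - inner ℂ v f‖ ≤ η * ‖f‖ := by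
  let L : Completion V →L[ℂ] ℂ := l.extend (Completion.toComplL (𝕜 := ℂ) (E := V))
  have hL : ∀ f : V, L f = l f := fun f =>
    l.extend_eq (Completion.denseRange_coe) (Completion.isUniformInducing_coe V) f
  let w : Completion V := (InnerProductSpace.toDual ℂ (Completion V)).symm L
  have hw : ∀ f : V, inner ℂ w (f : Completion V) = l f := fun f => by
    rw [InnerProductSpace.toDual_symm_apply, hL]
  obtain ⟨v, hv⟩ := (Completion.denseRange_coe (α := V)).exists_dist_lt w hη
  refine ⟨v, fun f => ?_⟩
  rw [← hw, ← Completion.inner_coe v, ← inner_sub_left]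
  refine (norm_inner_le_norm _ _).trans ?_
  rw [Completion.norm_coe, ← dist_eq_norm]
  gcongr

theorem exists_orthonormal_sum_norm_sq_le_of_continuous {V : Type*} [NormedAddCommGroup V]
    [InnerProductSpace ℂ V] {ι : Type*} [Fintype ι] (l : ι → V →L[ℂ] ℂ) {η : ℝ} (hη : 0 < η) :
    ∃ C : ℝ, 0 < C ∧ ∃ (N : ℕ) (e : Fin N → V), Orthonormal ℂ e ∧
      ∀ f : V, ∑ i, ‖l i f‖ ^ 2 ≤ η * ‖f‖ ^ 2 + C * ∑ n, ‖inner ℂ (e n) f‖ ^ 2 := by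
  set c : ℝ := (Fintype.card ι : ℝ) with hc
  set κ : ℝ := √(η / (2 * (c + 1))) with hκ
  have hκ0 : 0 < κ := by positivity
  choose v hv using fun i => exists_norm_sub_inner_le (l i) hκ0
  let S : Submodule ℂ V := Submodule.span ℂ (Set.range v)
  have : FiniteDimensional ℂ S := FiniteDimensional.span_of_finite ℂ (Set.finite_range v)
  let b := stdOrthonormalBasis ℂ S
  refine ⟨2 * ∑ i, ‖v i‖ ^ 2 + 1, by positivity, Module.finrank ℂ S, fun n => (b n : V),
    b.orthonormal.comp_linearIsometry S.subtypeₗᵢ, fun f => ?_⟩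
  set X : ℝ := ∑ n, ‖inner ℂ (b n : V) f‖ ^ 2
  have hX : ‖S.orthogonalProjectionOnto f‖ ^ 2 = X := by
    rw [← b.sum_sq_norm_inner_right]
    refine Finset.sum_congr rfl fun n _ => ?_
    rw [Submodule.inner_orthogonalProjectionOnto_eq_of_mem_left]
  have hvf : ∀ i, ‖inner ℂ (v i) f‖ ^ 2 ≤ ‖v i‖ ^ 2 * X := fun i => by
    have hvi : v i ∈ S := Submodule.subset_span ⟨i, rfl⟩
    have h : inner ℂ (v i) f = inner ℂ (v i) (S.orthogonalProjectionOnto f : V) :=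
      (Submodule.inner_orthogonalProjectionOnto_eq_of_mem_left ⟨v i, hvi⟩ f).symm
    rw [h, ← hX, ← mul_pow]
    exact pow_le_pow_left₀ (norm_nonneg _) (norm_inner_le_norm _ _) 2
  have hone : ∀ i, ‖l i f‖ ^ 2 ≤ 2 * (κ ^ 2 * ‖f‖ ^ 2) + 2 * (‖v i‖ ^ 2 * X) := fun i => by
    have h1 : ‖l i f‖ ≤ κ * ‖f‖ + ‖inner ℂ (v i) f‖ := by
      calc ‖l i f‖ = ‖(l i f - inner ℂ (v i) f) + inner ℂ (v i) f‖ := by rw [sub_add_cancel]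
        _ ≤ _ := (norm_add_le _ _).trans (by gcongr; exact hv i f)
    calc ‖l i f‖ ^ 2 ≤ (κ * ‖f‖ + ‖inner ℂ (v i) f‖) ^ 2 := by gcongr
      _ ≤ 2 * ((κ * ‖f‖) ^ 2 + ‖inner ℂ (v i) f‖ ^ 2) := add_sq_le
      _ ≤ _ := by rw [mul_pow]; linarith [hvf i]
  have hX0 : 0 ≤ X := by positivity
  calc ∑ i, ‖l i f‖ ^ 2 ≤ ∑ i, (2 * (κ ^ 2 * ‖f‖ ^ 2) + 2 * (‖v i‖ ^ 2 * X)) :=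
        Finset.sum_le_sum fun i _ => hone i
    _ = c * (2 * κ ^ 2) * ‖f‖ ^ 2 + 2 * (∑ i, ‖v i‖ ^ 2) * X := by
        rw [Finset.sum_add_distrib, Finset.sum_const, ← Finset.mul_sum, ← Finset.sum_mul,
          Finset.card_univ, nsmul_eq_mul]
        ring
    _ ≤ _ := by
        have : c * (2 * κ ^ 2) ≤ η := by
          rw [hκ, Real.sq_sqrt (by positivity), mul_div_assoc', mul_div_mul_left _ _ two_ne_zero,
            mul_div_assoc', div_le_iff₀ (by positivity)]
          nlinarith
        gcongr
        linarith

/-- Finitely many bounded functionals are controlled, up to a small multiple of the norm, by the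
coefficients with respect to a finite orthonormal family. -/
theorem exists_orthonormal_sum_norm_sq_le {V : Type*} [AddCommGroup V] [Module ℂ V]
    (ip : InnerProductSpace.Core ℂ V) {ι : Type*} [Fintype ι] (l : ι → V →ₗ[ℂ] ℂ) {M : ℝ}
    (hl : ∀ i f, ‖l i f‖ ≤ M * inducedNorm ip f) {η : ℝ} (hη : 0 < η) :
    ∃ C : ℝ, 0 < C ∧ ∃ (N : ℕ) (e : Fin N → V),
      (∀ i j : Fin N, ip.inner (e i) (e j) = if i = j then 1 else 0) ∧
      ∀ f : V, ∑ i, ‖l i f‖ ^ 2 ≤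
        η * inducedNorm ip f ^ 2 + C * ∑ n, ‖ip.inner (e n) f‖ ^ 2 := by
  let : NormedAddCommGroup V := ip.toNormedAddCommGroup
  let : InnerProductSpace ℂ V := InnerProductSpace.ofCore ip.toCore
  obtain ⟨C, hC, N, e, he, h⟩ := exists_orthonormal_sum_norm_sq_le_of_continuous
    (fun i => (l i).mkContinuous M (hl i)) hη
  exact ⟨C, hC, N, e, orthonormal_iff_ite.mp he, h⟩

end InnerProduct

/-! ### Derivatives in Sobolev spaces -/

section MultiDeriv

variable {d : ℕ} {φ : EuclideanSpace ℝ (Fin d) → ℝ}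

theorem IsTest.partialDeriv_comm (hφ : IsTest φ) (i j : Fin d) :
    BallSobolev.partialDeriv i (BallSobolev.partialDeriv j φ) =
      BallSobolev.partialDeriv j (BallSobolev.partialDeriv i φ) := by
  have h : ContDiff ℝ ∞ (fderiv ℝ φ) := hφ.smooth.fderiv_right (by simp)
  have hsnd : ∀ (a b : Fin d) x, BallSobolev.partialDeriv a (BallSobolev.partialDeriv b φ) x =
      fderiv ℝ (fderiv ℝ φ) x (EuclideanSpace.single a 1) (EuclideanSpace.single b 1) := by
    intro a b x
    unfold BallSobolev.partialDeriv
    rw [fderiv_clm_apply (h.differentiable (by simp) x) (differentiableAt_const _)]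
    simp
  ext x
  rw [hsnd, hsnd]
  have hn : minSmoothness ℝ 2 ≤ (∞ : WithTop ℕ∞) := by
    rw [minSmoothness_of_isRCLikeNormedField]
    exact WithTop.coe_le_coe.mpr (le_top : (2 : ℕ∞) ≤ ⊤)
  exact hφ.smooth.contDiffAt.isSymmSndFDerivAt hn _ _

theorem IsTest.iterate_partialDeriv (hφ : IsTest φ) (i : Fin d) (n : ℕ) :
    IsTest ((BallSobolev.partialDeriv i)^[n] φ) := by
  induction n with
  | zero => exact hφ
  | succ n ih => rw [Function.iterate_succ_apply']; exact ih.partialDeriv i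

theorem IsTest.iterate_partialDeriv_comm (hφ : IsTest φ) (i j : Fin d) (n : ℕ) :
    (BallSobolev.partialDeriv i)^[n] (BallSobolev.partialDeriv j φ) =
      BallSobolev.partialDeriv j ((BallSobolev.partialDeriv i)^[n] φ) := by
  induction n with
  | zero => rfl
  | succ n ih =>
    rw [Function.iterate_succ_apply', Function.iterate_succ_apply', ih,
      (hφ.iterate_partialDeriv i n).partialDeriv_comm]

theorem IsTest.foldr (hφ : IsTest φ) (α : Fin d → ℕ) (l : List (Fin d)) :
    IsTest (l.foldr (fun i h => (BallSobolev.partialDeriv i)^[α i] h) φ) := by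
  induction l with
  | nil => exact hφ
  | cons i l ih => exact ih.iterate_partialDeriv i _

theorem IsTest.foldr_partialDeriv (hφ : IsTest φ) (α : Fin d → ℕ) (j : Fin d)
    (l : List (Fin d)) :
    l.foldr (fun i h => (BallSobolev.partialDeriv i)^[α i] h) (BallSobolev.partialDeriv j φ) =
      BallSobolev.partialDeriv j (l.foldr (fun i h => (BallSobolev.partialDeriv i)^[α i] h) φ) := by
  induction l with
  | nil => rfl
  | cons i l ih =>
    rw [List.foldr_cons, List.foldr_cons, ih, (hφ.foldr α l).iterate_partialDeriv_comm]

/-- Each variable occurs at most once among the successive derivatives, so that raising `α_j` by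
one adds one derivative if `j` occurs and none otherwise. -/
theorem IsTest.foldr_add_single (hφ : IsTest φ) (α : Fin d → ℕ) (j : Fin d)
    (l : List (Fin d)) (hl : l.Nodup) :
    l.foldr (fun i h => (BallSobolev.partialDeriv i)^[(α + Pi.single j 1 : Fin d → ℕ) i] h) φ =
      if j ∈ l then
        BallSobolev.partialDeriv j (l.foldr (fun i h => (BallSobolev.partialDeriv i)^[α i] h) φ)
      else l.foldr (fun i h => (BallSobolev.partialDeriv i)^[α i] h) φ := by
  induction l with
  | nil => rfl
  | cons i l ih =>
    obtain ⟨hil, hl'⟩ := List.nodup_cons.mp hl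
    rw [List.foldr_cons, List.foldr_cons, ih hl']
    rcases eq_or_ne j i with rfl | hij
    · simp [hil, Function.iterate_succ_apply']
    · have hα : (α + Pi.single j 1 : Fin d → ℕ) i = α i := by simp [hij.symm]
      rw [hα]
      by_cases hjl : j ∈ l
      · simp [hjl, (hφ.foldr α l).iterate_partialDeriv_comm]
      · simp [hjl, hij]

theorem IsTest.multiDeriv_add_single (hφ : IsTest φ) (α : Fin d → ℕ) (j : Fin d) :
    BallSobolev.multiDeriv (α + Pi.single j 1) φ =
      BallSobolev.multiDeriv α (BallSobolev.partialDeriv j φ) := by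
  unfold BallSobolev.multiDeriv
  rw [hφ.foldr_add_single α j _ (List.nodup_finRange d), if_pos (List.mem_finRange j),
    hφ.foldr_partialDeriv]

end MultiDeriv

section Sobolev

variable {d m k : ℕ}

/-- The weak derivatives of `f` of order `α + e_i` form the weak gradient of the one of order
`α`: test the latter against `∂_i φ`. -/
theorem isWeakGradient_of_hasWeakDeriv {α : Fin d → ℕ} {f u : L2 d m} {g : Fin d → L2 d m}
    (hu : HasWeakDeriv α f u) (hg : ∀ i, HasWeakDeriv (α + Pi.single i 1) f (g i)) :
    IsWeakGradient u g := by
  intro i φ hφ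
  have h1 := hu _ (hφ.partialDeriv i)
  have h2 := hg i φ hφ
  rw [hφ.multiDeriv_add_single, h1] at h2
  have hs : ∑ j, (α + Pi.single i 1 : Fin d → ℕ) j = ∑ j, α j + 1 := by
    simp [Finset.sum_add_distrib]
  rw [hs, pow_succ, mul_smul, neg_one_smul] at h2
  exact smul_right_injective _ (pow_ne_zero _ (by norm_num)) h2

theorem hasWeakDeriv_weakDeriv (f : H d m k) {α : Fin d → ℕ} (hα : ∑ i, α i ≤ k) :
    HasWeakDeriv α (f : L2 d m) (weakDeriv α (f : L2 d m)) := by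
  obtain ⟨g, hg⟩ := f.2 α hα
  rwa [hg.weakDeriv_eq]

/-- The weak derivative `∂^α` with `|α| ≤ k`, as a linear map on `H^k`. -/
def weakDerivₗ (α : Fin d → ℕ) (hα : ∑ i, α i ≤ k) : H d m k →ₗ[ℂ] L2 d m where
  toFun f := weakDeriv α (f : L2 d m)
  map_add' f g :=
    ((hasWeakDeriv_weakDeriv f hα).add (hasWeakDeriv_weakDeriv g hα)).weakDeriv_eq
  map_smul' c f := ((hasWeakDeriv_weakDeriv f hα).smul c).weakDeriv_eq

theorem mem_multiIndices {j : ℕ} {α : Fin d → ℕ} : α ∈ multiIndices d j ↔ ∑ i, α i = j := by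
  simp [multiIndices]

theorem homNorm_sq (j : ℕ) (f : L2 d m) :
    homNorm j f ^ 2 = ∑ α ∈ multiIndices d j, ‖weakDeriv α f‖ ^ 2 :=
  Real.sq_sqrt (by positivity)

theorem sobolevNorm_sq (j : ℕ) (f : L2 d m) :
    sobolevNorm j f ^ 2 = ∑ i ∈ Finset.range (j + 1), homNorm i f ^ 2 := by
  simp only [homNorm_sq]
  exact Real.sq_sqrt (by positivity)

theorem norm_weakDeriv_le_sobolevNorm {α : Fin d → ℕ} (hα : ∑ i, α i ≤ k) (f : L2 d m) :
    ‖weakDeriv α f‖ ≤ sobolevNorm k f := by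
  refine Real.le_sqrt_of_sq_le ?_
  calc ‖weakDeriv α f‖ ^ 2 ≤ ∑ β ∈ multiIndices d (∑ i, α i), ‖weakDeriv β f‖ ^ 2 :=
        Finset.single_le_sum (f := fun β => ‖weakDeriv β f‖ ^ 2) (fun _ _ => by positivity)
          (mem_multiIndices.mpr rfl)
    _ ≤ _ := Finset.single_le_sum
        (f := fun j => ∑ β ∈ multiIndices d j, ‖weakDeriv β f‖ ^ 2) (fun _ _ => by positivity)
        (Finset.mem_range.mpr (by omega))

/-- Every multi-index of length `j + 1` arises in at most `d` ways as `α + e_i`. -/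
theorem sum_sum_norm_weakDeriv_add_single_le (j : ℕ) (f : L2 d m) :
    ∑ α ∈ multiIndices d j, ∑ i, ‖weakDeriv (α + Pi.single i 1) f‖ ^ 2 ≤
      d * homNorm (j + 1) f ^ 2 := by
  rw [Finset.sum_comm]
  calc _ ≤ ∑ _i : Fin d, homNorm (j + 1) f ^ 2 := by
        refine Finset.sum_le_sum fun i _ => ?_
        rw [homNorm_sq, ← Finset.sum_image (f := fun β => ‖weakDeriv β f‖ ^ 2)
          (g := fun α : Fin d → ℕ => α + (Pi.single i 1 : Fin d → ℕ)) (add_left_injective _).injOn]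
        refine Finset.sum_le_sum_of_subset_of_nonneg (fun β hβ => ?_) fun _ _ _ => by positivity
        obtain ⟨α, hα, rfl⟩ := Finset.mem_image.mp hβ
        rw [mem_multiIndices] at hα ⊢
        simp [Finset.sum_add_distrib, hα]
    _ = _ := by simp

/-- An estimate of `L²` functions by their weak gradients and some functionals, applied to the
weak derivatives of order `j < k` of an element of `H^k`. -/
theorem homNorm_sq_le_of_functionals {δ : ℝ} (hδ : 0 ≤ δ) {ι : Type*} [Fintype ι]
    {l : ι → L2 d m →L[ℂ] ℂ}
    (hl : ∀ (u : L2 d m) (g : Fin d → L2 d m), IsWeakGradient u g →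
      ‖u‖ ^ 2 ≤ δ * ∑ i, ‖g i‖ ^ 2 + ∑ n, ‖l n u‖ ^ 2)
    (f : H d m k) {j : ℕ} (hj : j < k) :
    homNorm j (f : L2 d m) ^ 2 ≤ δ * (d * homNorm (j + 1) (f : L2 d m) ^ 2) +
      ∑ α ∈ multiIndices d j, ∑ n, ‖l n (weakDeriv α (f : L2 d m))‖ ^ 2 := by
  rw [homNorm_sq j]
  have hsum := Finset.sum_le_sum fun α (hα : α ∈ multiIndices d j) =>
    hl (weakDeriv α (f : L2 d m))
      (fun i => weakDeriv (α + Pi.single i 1) (f : L2 d m)) <| by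
      have hαk : ∑ i, α i < k := by rwa [mem_multiIndices.mp hα]
      refine isWeakGradient_of_hasWeakDeriv (hasWeakDeriv_weakDeriv f hαk.le) fun i =>
        hasWeakDeriv_weakDeriv f ?_
      simpa [Finset.sum_add_distrib] using hαk
  refine hsum.trans ?_
  rw [Finset.sum_add_distrib, ← Finset.mul_sum]
  gcongr
  exact sum_sum_norm_weakDeriv_add_single_le j _

end Sobolev

end BallSobolev

end

/-! ### Absorption of the lower order terms -/

/- An `InnerProductSpace.Core` is linear in its second argument, so `(f|g)`, linear in `f`, is
`ip.inner g f`. -/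
theorem propositionA3 (d m k : ℕ) (hd : 1 ≤ d) (hm : 1 ≤ m) (hk : 1 ≤ k)
    (ip : InnerProductSpace.Core ℂ (BallSobolev.H d m k))
    (hip : BallSobolev.EquivalentToSobolev ip) (ε : ℝ) (hε : 0 < ε) :
    ∃ C : ℝ, 0 < C ∧ ∃ (N : ℕ) (e : Fin N → BallSobolev.H d m k),
      (∀ i j : Fin N, ip.inner (e i) (e j) = if i = j then 1 else 0) ∧
      ∀ f : BallSobolev.H d m k,
        BallSobolev.sobolevNorm (k - 1) (f : BallSobolev.L2 d m) ^ 2 ≤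
          ε * BallSobolev.homNorm k (f : BallSobolev.L2 d m) ^ 2 +
            C * ∑ n : Fin N, ‖ip.inner (e n) f‖ ^ 2 := by
  obtain ⟨a, b, ha, hb, hab⟩ := hip
  -- `τ ≤ 1 / 2` permits absorption, which doubles the constant; hence `2 * τ ≤ ε`.
  set τ : ℝ := min (1 / 2) (ε / 2)
  have hτ : 0 < τ := by positivity
  have hτ2 : τ ≤ 1 / 2 := min_le_left _ _
  have hτε : 2 * τ ≤ ε := by linarith [min_le_right (1 / 2 : ℝ) (ε / 2)]
  obtain ⟨ι, _, l, hl⟩ := BallSobolev.exists_functionals_norm_sq_le d m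
    (δ := τ / (2 * (d + 1))) (by positivity)
  have hA : ∀ p : ((Finset.range k).sigma (BallSobolev.multiIndices d) :
      Finset (Σ _ : ℕ, Fin d → ℕ)), ∑ i, p.1.2 i < k := fun p => by
    obtain ⟨h1, h2⟩ := Finset.mem_sigma.mp p.2
    rw [BallSobolev.mem_multiIndices.mp h2]
    exact Finset.mem_range.mp h1
  -- The functionals `f ↦ l_n (∂^α f)`, indexed by the pairs of `α` with `|α| < k` and `n`.
  let L : ((Finset.range k).sigma (BallSobolev.multiIndices d) :
      Finset (Σ _ : ℕ, Fin d → ℕ)) × ι → BallSobolev.H d m k →ₗ[ℂ] ℂ := fun p =>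
    (l p.2).toLinearMap ∘ₗ BallSobolev.weakDerivₗ p.1.1.2 (hA p.1).le
  have hLM : ∀ p f, ‖L p f‖ ≤ ((∑ n, ‖l n‖) / a) * BallSobolev.inducedNorm ip f := by
    intro p f
    have h1 : ‖L p f‖ ≤ ‖l p.2‖ * ‖BallSobolev.weakDeriv p.1.1.2 (f : BallSobolev.L2 d m)‖ :=
      (l p.2).le_opNorm _
    have h2 : ‖l p.2‖ ≤ ∑ n, ‖l n‖ :=
      Finset.single_le_sum (f := fun n => ‖l n‖) (fun _ _ => norm_nonneg _) (Finset.mem_univ _)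
    have h3 : BallSobolev.sobolevNorm k (f : BallSobolev.L2 d m) ≤
        BallSobolev.inducedNorm ip f / a := by
      rw [le_div_iff₀ ha, mul_comm]
      exact (hab f).1
    calc ‖L p f‖ ≤ (∑ n, ‖l n‖) * (BallSobolev.inducedNorm ip f / a) := by
          refine h1.trans (mul_le_mul h2 ?_ (norm_nonneg _) (by positivity))
          exact (BallSobolev.norm_weakDeriv_le_sobolevNorm (hA p.1).le _).trans h3
      _ = _ := by ring
  obtain ⟨C, hC, N, e, he, h⟩ := BallSobolev.exists_orthonormal_sum_norm_sq_le ip L hLM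
    (η := τ / (2 * b ^ 2)) (by positivity)
  refine ⟨2 * C, by positivity, N, e, he, fun f => ?_⟩
  have hgrad : ∀ j ∈ Finset.range k, BallSobolev.homNorm j (f : BallSobolev.L2 d m) ^ 2 ≤
      τ / 2 * BallSobolev.homNorm (j + 1) (f : BallSobolev.L2 d m) ^ 2 +
        ∑ α ∈ BallSobolev.multiIndices d j, ∑ n,
          ‖l n (BallSobolev.weakDeriv α (f : BallSobolev.L2 d m))‖ ^ 2 := by
    intro j hj
    refine (BallSobolev.homNorm_sq_le_of_functionals (by positivity) hl f
      (Finset.mem_range.mp hj)).trans (add_le_add ?_ le_rfl)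
    rw [← mul_assoc]
    refine mul_le_mul_of_nonneg_right ?_ (sq_nonneg _)
    rw [div_mul_eq_mul_div, div_le_div_iff₀ (by positivity) two_pos]
    nlinarith
  set S : ℝ := BallSobolev.sobolevNorm (k - 1) (f : BallSobolev.L2 d m) ^ 2 with hS
  set A : ℝ := BallSobolev.homNorm k (f : BallSobolev.L2 d m) ^ 2 with hAdef
  set X : ℝ := ∑ n : Fin N, ‖ip.inner (e n) f‖ ^ 2
  have hSsum : S = ∑ j ∈ Finset.range k, BallSobolev.homNorm j (f : BallSobolev.L2 d m) ^ 2 := by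
    rw [hS, BallSobolev.sobolevNorm_sq, Nat.sub_add_cancel hk]
  have hSA : BallSobolev.sobolevNorm k (f : BallSobolev.L2 d m) ^ 2 = S + A := by
    rw [BallSobolev.sobolevNorm_sq, Finset.sum_range_succ, hSsum]
  have hshift : ∑ j ∈ Finset.range k, BallSobolev.homNorm (j + 1) (f : BallSobolev.L2 d m) ^ 2 ≤
      S + A := by
    rw [← hSA, BallSobolev.sobolevNorm_sq, Finset.sum_range_succ']
    linarith [sq_nonneg (BallSobolev.homNorm 0 (f : BallSobolev.L2 d m))]
  have hT : ∑ p, ‖L p f‖ ^ 2 = ∑ j ∈ Finset.range k, ∑ α ∈ BallSobolev.multiIndices d j, ∑ n,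
      ‖l n (BallSobolev.weakDeriv α (f : BallSobolev.L2 d m))‖ ^ 2 := by
    rw [Fintype.sum_prod_type]
    exact (Finset.sum_coe_sort _ fun q : Σ _ : ℕ, Fin d → ℕ =>
      ∑ n, ‖l n (BallSobolev.weakDeriv q.2 (f : BallSobolev.L2 d m))‖ ^ 2).trans
      (Finset.sum_sigma _ _ _)
  have h1 : S ≤ τ / 2 * (S + A) + ∑ p, ‖L p f‖ ^ 2 := by
    rw [hT]
    calc S ≤ _ := hSsum.le.trans (Finset.sum_le_sum hgrad)
      _ ≤ _ := by
        rw [Finset.sum_add_distrib, ← Finset.mul_sum]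
        gcongr
  have h2 : τ / (2 * b ^ 2) * BallSobolev.inducedNorm ip f ^ 2 ≤ τ / 2 * (S + A) := by
    calc _ ≤ τ / (2 * b ^ 2) * (b * BallSobolev.sobolevNorm k (f : BallSobolev.L2 d m)) ^ 2 := by
          gcongr
          · exact Real.sqrt_nonneg _
          · exact (hab f).2
      _ = _ := by rw [mul_pow, hSA]; field_simp
  have h3 := h f
  have hS0 : 0 ≤ S := sq_nonneg _
  have hA0 : 0 ≤ A := sq_nonneg _
  -- The terms `τ * S` with `τ ≤ 1 / 2` are absorbed into the left-hand side.
  have h4 : τ * S ≤ 1 / 2 * S := by gcongr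
  have h5 : 2 * τ * A ≤ ε * A := by gcongr
  linarith
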